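/- Let $\Omega\subset\mathbb{R}^2$ be a nonempty bounded open set, let $d_1,d_2\ge 0$ be integers and, for $i=1,2$, let $P_i:\mathbb{R}^{2\times 2}\to\mathbb{R}^{d_i}$ be a linear map. For $\varphi\in C_c^\infty(\Omega,\mathbb{R}^2)$ put $\mathcal P_i\varphi=P_i(\mathrm D\varphi)$, where $\mathrm D\varphi=(\partial_j\varphi_i)_{ij}$ is the Jacobian matrix. (a) Suppose that there is a constant $C$ such that $$\|\mathcal P_1\varphi\|_{L^1(\Omega)}\le C\,\|\mathcal P_2\varphi\|_{L^1(\Omega)}\qquad\text{for all }\varphi\in C_c^\infty(\Omega,\mathbb{R}^2).$$ Then there is a linear map $T:\mathbb{R}^{d_2}\to\mathbb{R}^{d_1}$ such that $P_1=T\circ P_2$. (b) Suppose that there is a constant $C$ such that the inequality in (a) holds for all those $\varphi\in C_c^\infty(\Omega,\mathbb{R}^2)$ that are of the form $\varphi=\nabla\phi$ for some $\phi\in C_c^\infty(\Omega,\mathbb{R})$. Then there is a linear map $T:\mathbb{R}^{d_2}\to\mathbb{R}^{d_1}$ such that $P_1A=T(P_2A)$ for all symmetric matrices $A\in\mathbb{R}^{2\times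 2}$, that is, $P_1=T\circ P_2$ on $\mathbb{R}^{2\times 2}_{\mathrm{sym}}$. -/

import Mathlib

open MeasureTheory TopologicalSpace
open scoped Distributions Gradient

noncomputable section

namespace OrnsteinPlane

/-- The Euclidean plane. -/
abbrev Plane : Type := EuclideanSpace ℝ (Fin 2)

/-- Real two-by-two matrices. -/
abbrev Mat : Type := Matrix (Fin 2) (Fin 2) ℝ

/-- The Jacobian matrix of a planar vector field, with entries `∂ⱼ φᵢ`. -/
def jacobian (φ : Plane → Plane) (x : Plane) : Mat :=
  Matrix.of fun i j => (fderiv ℝ φ x (EuclideanSpace.single j 1)) i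

/-- The first-order operator `φ ↦ P (D φ)` given by a linear map `P` on matrices. -/
def firstOrderOp {d : ℕ} (P : Mat →ₗ[ℝ] EuclideanSpace ℝ (Fin d)) (φ : Plane → Plane) :
    Plane → EuclideanSpace ℝ (Fin d) :=
  fun x => P (jacobian φ x)

/-- The `L¹` norm over `Ω`. It is applied only to continuous functions with compact support,
for which the integral converges. -/
def l1Norm {d : ℕ} (Ω : Opens Plane) (u : Plane → EuclideanSpace ℝ (Fin d)) : ℝ :=
  ∫ x in (Ω : Set Plane), ‖u x‖

end OrnsteinPlane

end

/-!
The theorem reduces to an inclusion of kernels: if `P₂ A = 0` for a symmetric matrix `A`, then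
`P₁ A = 0`. Suppose the `L¹` estimate holds with constant `C` and put `h X = C ‖P₂ X‖ - ‖P₁ X‖`. This
function is Lipschitz and positively homogeneous of degree one, and `∫ h (D²ϕ) ≥ 0` for all test
functions `ϕ` on `Ω`. Since `h A + h (-A) = -2 ‖P₁ A‖`, it suffices to find a function below `h`
on symmetric matrices whose values at `A` and `-A` have a nonnegative sum.

* Multiplying rapid oscillations of a periodic function `f` by a fixed cutoff function shows that
  the mean of `h (D²f)` over a period is nonnegative (`LipschitzHomogeneous.energy_nonneg`).
* Hence the envelope `X ↦ inf_f mean h (X + D²f)`, over smooth periodic `f`, is finite. It lies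
  below `h` and is again Lipschitz and positively homogeneous.
* The envelope is convex in the rank-one directions `k ⊗ k` with `k = (m, 1)`, `m ∈ ℤ`
  (`LipschitzHomogeneous.two_mul_envelope_le`): a coarse plane wave takes the values
  `± s (k ⊗ k)` on alternating stripes, and on them one superposes fast oscillations that are
  nearly optimal for `X ± s (k ⊗ k)`. No tilings are needed: averaging over the phase of the fast
  oscillation decouples the two scales exactly (`le_of_forall_le_integral_oscillation`).
* A positively homogeneous Lipschitz function that is convex in finitely many directions dominates
  a linear function on their span (`LipschitzHomogeneous.nonneg_add_neg`, an argument of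
  Kirchheim and Kristensen). Replacing `g` by its directional derivative at one of the directions
  makes it smaller and affine in that direction, and keeps all other properties; this is
  repeated for each direction. The matrices `k ⊗ k` for `m = -1, 0, 1` span the symmetric
  matrices.

For general vector fields the same is applied to the fields `B ∇ϕ`, whose Jacobian is `B D²ϕ`. As
every matrix is a product `B S` with `S` symmetric, this gives the kernel inclusion on all
matrices.
-/

open Filter Set
open scoped Topology ContDiff Matrix.Norms.Elementwise

namespace OrnsteinPlane

/-! ### Positively homogeneous functions that are convex in some directions -/

section Homogeneous

variable {E : Type*} [NormedAddCommGroup E] [NormedSpace ℝ E]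

/-- Midpoint convexity of `g` on every line of direction `v`. -/
def MidconvexAlong (g : E → ℝ) (v : E) : Prop :=
  ∀ (y : E) (s : ℝ), 2 * g y ≤ g (y + s • v) + g (y - s • v)

/-- `g` is Lipschitz with constant `L` and positively homogeneous of degree one. -/
structure LipschitzHomogeneous (L : ℝ) (g : E → ℝ) : Prop where
  nonneg : 0 ≤ L
  abs_sub_le : ∀ x y, |g x - g y| ≤ L * ‖x - y‖
  map_smul : ∀ (t : ℝ) (x : E), 0 < t → g (t • x) = t * g x

/-- `g` is affine with slope `c` on every line of direction `v`. -/
def AffineAlong (g : E → ℝ) (v : E) (c : ℝ) : Prop :=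
  ∀ (y : E) (s : ℝ), g (y + s • v) = g y + s * c

theorem LipschitzHomogeneous.map_zero {L : ℝ} {g : E → ℝ} (hg : LipschitzHomogeneous L g) :
    g 0 = 0 := by
  have := hg.map_smul 2 0 two_pos
  rw [smul_zero] at this
  linarith

theorem LipschitzHomogeneous.continuous {L : ℝ} {g : E → ℝ} (hg : LipschitzHomogeneous L g) :
    Continuous g :=
  (LipschitzWith.of_dist_le' fun x y => by
    simpa [dist_eq_norm, Real.dist_eq] using hg.abs_sub_le x y).continuous

theorem LipschitzHomogeneous.le_add {L r : ℝ} {g : E → ℝ} (hg : LipschitzHomogeneous L g)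
    {x y : E} (h : ‖x - y‖ ≤ r) : g x ≤ g y + L * r := by
  linarith [(abs_le.1 (hg.abs_sub_le x y)).2, mul_le_mul_of_nonneg_left h hg.nonneg]

/-- A Lipschitz function fails to be convex on a segment by no more than this. -/
theorem LipschitzHomogeneous.map_segment_le {L : ℝ} {g : E → ℝ} (hg : LipschitzHomogeneous L g)
    {θ : ℝ} (h0 : 0 ≤ θ) (h1 : θ ≤ 1) (u v : E) :
    g (θ • u + (1 - θ) • v) ≤ θ * g u + (1 - θ) * g v + 2 * L * (θ * (1 - θ)) * ‖u - v‖ := by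
  have hu := hg.le_add (x := θ • u + (1 - θ) • v) (y := u) (r := (1 - θ) * ‖u - v‖) (by
    rw [show θ • u + (1 - θ) • v - u = (-(1 - θ)) • (u - v) by module, norm_smul, norm_neg,
      Real.norm_of_nonneg (by linarith)])
  have hv := hg.le_add (x := θ • u + (1 - θ) • v) (y := v) (r := θ * ‖u - v‖) (by
    rw [show θ • u + (1 - θ) • v - v = θ • (u - v) by module, norm_smul,
      Real.norm_of_nonneg h0])
  have hu' := mul_le_mul_of_nonneg_left hu h0
  have hv' := mul_le_mul_of_nonneg_left hv (sub_nonneg.2 h1)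
  linarith

/-- A function on the line that is midpoint convex and bounded above near `+∞` is antitone:
an increase from `a` to `b` would reproduce itself on each of the following steps of length
`b - a`. -/
theorem antitone_of_midconvex_of_le {F : ℝ → ℝ} {K : ℝ}
    (hmid : ∀ t s, 2 * F t ≤ F (t + s) + F (t - s)) (hK : ∀ t, 0 ≤ t → F t ≤ K) :
    Antitone F := by
  intro a b hab
  by_contra! hlt
  have hab' : 0 < b - a := by
    rcases hab.eq_or_lt with h | h
    · exact absurd (h ▸ hlt) (lt_irrefl _)
    · linarith
  have hstep : ∀ n : ℕ, F b - F a ≤ F (a + (n + 1) * (b - a)) - F (a + n * (b - a)) := by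
    intro n
    induction n with
    | zero => simp
    | succ n ih =>
      have h := hmid (a + (n + 1) * (b - a)) (b - a)
      rw [show a + (n + 1) * (b - a) - (b - a) = a + n * (b - a) by ring,
        show a + (n + 1) * (b - a) + (b - a) = a + (n + 1 + 1) * (b - a) by ring] at h
      push_cast
      linarith
  have hgrow : ∀ n : ℕ, F a + n * (F b - F a) ≤ F (a + n * (b - a)) := by
    intro n
    induction n with
    | zero => simp
    | succ n ih =>
      have := hstep n
      push_cast
      linarith
  obtain ⟨n, hn⟩ := exists_nat_gt (max ((K - F a) / (F b - F a)) (-a / (b - a)))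
  have h1 : K - F a < n * (F b - F a) :=
    (div_lt_iff₀ (by linarith)).1 (lt_of_le_of_lt (le_max_left _ _) hn)
  have h2 : -a < n * (b - a) :=
    (div_lt_iff₀ hab').1 (lt_of_le_of_lt (le_max_right _ _) hn)
  have h3 := hK (a + n * (b - a)) (by linarith)
  linarith [hgrow n]

/-- The directional derivative `g'` of `g` at `x`, obtained as the limit of
`g (t • x + y) - t * g x` as `t → ∞`. If `g` is convex in the direction `x`, this expression
decreases in `t`, so that `g' ≤ g`; and `g'` is affine in the direction `x`, while it inherits
the convexity and affinity of `g` in other directions. -/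
theorem LipschitzHomogeneous.exists_affineAlong_le {L : ℝ} {g : E → ℝ}
    (hg : LipschitzHomogeneous L g) {x : E} (hx : MidconvexAlong g x) :
    ∃ g' : E → ℝ, LipschitzHomogeneous L g' ∧ (∀ y, g' y ≤ g y) ∧ AffineAlong g' x (g x) ∧
      (∀ v, MidconvexAlong g v → MidconvexAlong g' v) ∧
      (∀ v c, AffineAlong g v c → AffineAlong g' v c) := by
  have hbound : ∀ y t, 0 ≤ t → |g (t • x + y) - t * g x| ≤ L * ‖y‖ := by
    intro y t ht
    rcases ht.eq_or_lt with rfl | ht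
    · simpa [hg.map_zero] using hg.abs_sub_le y 0
    · simpa [hg.map_smul t x ht] using hg.abs_sub_le (t • x + y) (t • x)
  have hanti : ∀ y, Antitone fun t : ℝ => g (t • x + y) - t * g x := by
    intro y
    refine antitone_of_midconvex_of_le (K := L * ‖y‖) (fun t s => ?_)
      (fun t ht => (le_abs_self _).trans (hbound y t ht))
    have h := hx (t • x + y) s
    rw [show t • x + y + s • x = (t + s) • x + y by module,
      show t • x + y - s • x = (t - s) • x + y by module] at h
    linarith
  have hlim : ∀ y, ∃ l, Tendsto (fun t : ℝ => g (t • x + y) - t * g x) atTop (𝓝 l) := by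
    intro y
    refine ⟨_, tendsto_atTop_ciInf (hanti y) ⟨-(L * ‖y‖), ?_⟩⟩
    rintro _ ⟨t, rfl⟩
    refine le_trans ?_ (hanti y (le_max_left t 0))
    exact (abs_le.1 (hbound y (max t 0) (le_max_right _ _))).1
  choose g' hg' using hlim
  refine ⟨g', ⟨hg.nonneg, fun y z => ?_, fun s y hs => ?_⟩, fun y => ?_, fun y s => ?_,
    fun v hv y s => ?_, fun v c hv y s => ?_⟩
  · refine le_of_tendsto ((hg' y).sub (hg' z)).abs (Eventually.of_forall fun t => ?_)
    simpa using hg.abs_sub_le (t • x + y) (t • x + z)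
  · have h := ((hg' y).comp (tendsto_id.atTop_div_const hs)).const_mul s
    refine tendsto_nhds_unique (hg' (s • y)) (h.congr fun t => ?_)
    have hsc := hg.map_smul s ((t / s) • x + y) hs
    rw [smul_add, smul_smul, mul_div_cancel₀ _ hs.ne'] at hsc
    simp only [Function.comp_apply, id]
    rw [hsc]
    field_simp
  · simpa using (hanti y).le_of_tendsto (hg' y) 0
  · have h := ((hg' y).comp (tendsto_atTop_add_const_right _ s tendsto_id)).add_const (s * g x)
    refine tendsto_nhds_unique (hg' (y + s • x)) (h.congr fun t => ?_)
    simp only [Function.comp_apply, id]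
    rw [show (t + s) • x + y = t • x + (y + s • x) by module]
    ring
  · refine le_of_tendsto_of_tendsto ((hg' y).const_mul 2) ((hg' _).add (hg' _))
      (Eventually.of_forall fun t => ?_)
    have h := hv (t • x + y) s
    rw [add_assoc, add_sub_assoc] at h
    simp only
    linarith
  · refine tendsto_nhds_unique (hg' (y + s • v)) (((hg' y).add_const (s * c)).congr fun t => ?_)
    rw [← add_assoc, hv]
    ring

/-- A Lipschitz, positively homogeneous function that is convex in finitely many directions
dominates a function of the same kind that is affine in each of these directions. -/
theorem LipschitzHomogeneous.exists_forall_affineAlong_le {L : ℝ} {g : E → ℝ}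
    (hg : LipschitzHomogeneous L g) (S : Finset E) (hS : ∀ v ∈ S, MidconvexAlong g v) :
    ∃ g' : E → ℝ, LipschitzHomogeneous L g' ∧ (∀ y, g' y ≤ g y) ∧
      ∀ v ∈ S, ∃ c, AffineAlong g' v c := by
  classical
  suffices H : ∃ g' : E → ℝ, LipschitzHomogeneous L g' ∧ (∀ y, g' y ≤ g y) ∧
      (∀ v ∈ S, ∃ c, AffineAlong g' v c) ∧ (∀ v, MidconvexAlong g v → MidconvexAlong g' v) by
    obtain ⟨g', h1, h2, h3, -⟩ := H
    exact ⟨g', h1, h2, h3⟩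
  induction S using Finset.induction_on with
  | empty => exact ⟨g, hg, fun _ => le_rfl, by simp, fun _ h => h⟩
  | insert x S _ ih =>
    obtain ⟨g₁, h₁, hle₁, haff₁, hmid₁⟩ := ih fun v hv => hS v (Finset.mem_insert_of_mem hv)
    obtain ⟨g₂, h₂, hle₂, hx₂, hmid₂, haff₂⟩ :=
      h₁.exists_affineAlong_le (hmid₁ x (hS x (Finset.mem_insert_self _ _)))
    refine ⟨g₂, h₂, fun y => (hle₂ y).trans (hle₁ y), fun v hv => ?_,
      fun v hv => hmid₂ v (hmid₁ v hv)⟩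
    rcases Finset.mem_insert.1 hv with rfl | hv
    · exact ⟨_, hx₂⟩
    · obtain ⟨c, hc⟩ := haff₁ v hv
      exact ⟨c, haff₂ v c hc⟩

/-- A Lipschitz, positively homogeneous function that is convex in finitely many directions
is bounded below by a linear function on their span; in particular its values at `y` and `-y`
have a nonnegative sum. -/
theorem LipschitzHomogeneous.nonneg_add_neg {L : ℝ} {g : E → ℝ}
    (hg : LipschitzHomogeneous L g) (S : Finset E) (hS : ∀ v ∈ S, MidconvexAlong g v)
    {y : E} (hy : y ∈ Submodule.span ℝ (S : Set E)) : 0 ≤ g y + g (-y) := by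
  obtain ⟨g', hg', hle, haff⟩ := hg.exists_forall_affineAlong_le S hS
  have key : ∃ c, AffineAlong g' y c := by
    induction hy using Submodule.span_induction with
    | mem v hv => exact haff v hv
    | zero => exact ⟨0, fun y s => by simp⟩
    | add v w _ _ hv hw =>
      obtain ⟨c, hc⟩ := hv
      obtain ⟨d, hd⟩ := hw
      refine ⟨c + d, fun y s => ?_⟩
      rw [smul_add, ← add_assoc, hd, hc]
      ring
    | smul a v _ hv =>
      obtain ⟨c, hc⟩ := hv
      refine ⟨a * c, fun y s => ?_⟩
      rw [smul_smul, hc]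
      ring
  obtain ⟨c, hc⟩ := key
  have h1 := hc 0 1
  have h2 := hc 0 (-1)
  simp only [one_smul, zero_add, neg_smul, hg'.map_zero] at h1 h2
  linarith [hle y, hle (-y)]

end Homogeneous

/-! ### Partial derivatives and Hessians -/

/-- The partial derivative `∂ᵢ f` of a function on the plane. -/
noncomputable def pd (i : Fin 2) (f : Plane → ℝ) (x : Plane) : ℝ :=
  fderiv ℝ f x (EuclideanSpace.single i 1)

/-- The Hessian matrix of a function on the plane. -/
noncomputable def hess (f : Plane → ℝ) (x : Plane) : Mat :=
  Matrix.of fun i j => pd j (pd i f) x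

theorem hess_apply (f : Plane → ℝ) (x : Plane) (i j : Fin 2) :
    hess f x i j = pd j (pd i f) x := rfl

section Calculus

variable {f g : Plane → ℝ}

theorem contDiff_pd (hf : ContDiff ℝ ∞ f) (i : Fin 2) : ContDiff ℝ ∞ (pd i f) :=
  (hf.fderiv_right (m := ∞) (by simp)).clm_apply contDiff_const

theorem continuous_hess (hf : ContDiff ℝ ∞ f) : Continuous (hess f) :=
  continuous_matrix fun i j => (contDiff_pd (contDiff_pd hf i) j).continuous

theorem pd_add (hf : ContDiff ℝ ∞ f) (hg : ContDiff ℝ ∞ g) (i : Fin 2) :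
    pd i (fun x => f x + g x) = fun x => pd i f x + pd i g x := by
  funext x
  simp only [pd]
  rw [fderiv_fun_add (hf.differentiable (by simp) x) (hg.differentiable (by simp) x)]
  rfl

theorem pd_const_mul (hf : ContDiff ℝ ∞ f) (c : ℝ) (i : Fin 2) :
    pd i (fun x => c * f x) = fun x => c * pd i f x := by
  funext x
  simp only [pd]
  rw [fderiv_const_mul (hf.differentiable (by simp) x)]
  rfl

theorem pd_mul (hf : ContDiff ℝ ∞ f) (hg : ContDiff ℝ ∞ g) (i : Fin 2) :
    pd i (fun x => f x * g x) = fun x => f x * pd i g x + g x * pd i f x := by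
  funext x
  simp only [pd]
  rw [fderiv_fun_mul (hf.differentiable (by simp) x) (hg.differentiable (by simp) x)]
  rfl

theorem pd_comp_affine (hf : ContDiff ℝ ∞ f) (N : ℝ) (z : Plane) (i : Fin 2) :
    pd i (fun x => f (N • x + z)) = fun x => N * pd i f (N • x + z) := by
  funext x
  have h1 : HasFDerivAt (fun x : Plane => N • x + z) (N • ContinuousLinearMap.id ℝ Plane) x :=
    ((hasFDerivAt_id x).const_smul N).add_const z
  have h2 := ((hf.differentiable (by simp) (N • x + z)).hasFDerivAt).comp x h1
  simp only [pd]
  rw [show (fun x => f (N • x + z)) = f ∘ fun x => N • x + z from rfl, h2.fderiv]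
  simp

theorem pd_comp_inner {w : ℝ → ℝ} (hw : ContDiff ℝ ∞ w) (k : Plane) (i : Fin 2) :
    pd i (fun x => w (inner ℝ k x)) = fun x => k i * deriv w (inner ℝ k x) := by
  funext x
  have h1 : HasFDerivAt (fun x : Plane => inner ℝ k x) (innerSL ℝ k) x :=
    (innerSL ℝ k).hasFDerivAt
  have h2 := ((hw.differentiable (by simp) (inner ℝ k x)).hasDerivAt).comp_hasFDerivAt x h1
  simp only [pd]
  rw [show (fun x => w (inner ℝ k x)) = w ∘ fun x => inner ℝ k x from rfl, h2.fderiv]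
  simp [EuclideanSpace.inner_single_right, mul_comm]

theorem contDiff_comp_inner {w : ℝ → ℝ} (hw : ContDiff ℝ ∞ w) (k : Plane) :
    ContDiff ℝ ∞ fun x : Plane => w (inner ℝ k x) :=
  hw.comp (innerSL ℝ k).contDiff

theorem contDiff_comp_affine (hf : ContDiff ℝ ∞ f) (N : ℝ) (z : Plane) :
    ContDiff ℝ ∞ fun x : Plane => f (N • x + z) := by
  fun_prop

theorem hess_add (hf : ContDiff ℝ ∞ f) (hg : ContDiff ℝ ∞ g) (x : Plane) :
    hess (fun x => f x + g x) x = hess f x + hess g x := by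
  ext i j
  simp only [hess_apply, Matrix.add_apply, pd_add hf hg,
    pd_add (contDiff_pd hf i) (contDiff_pd hg i)]

theorem hess_const_mul (hf : ContDiff ℝ ∞ f) (c : ℝ) (x : Plane) :
    hess (fun x => c * f x) x = c • hess f x := by
  ext i j
  simp only [hess_apply, Matrix.smul_apply, pd_const_mul hf, pd_const_mul (contDiff_pd hf i),
    smul_eq_mul]

theorem hess_comp_inner {w : ℝ → ℝ} (hw : ContDiff ℝ ∞ w) (k x : Plane) :
    hess (fun x => w (inner ℝ k x)) x =
      deriv (deriv w) (inner ℝ k x) • Matrix.vecMulVec k k := by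
  have hw' : ContDiff ℝ ∞ (deriv w) := (contDiff_infty_iff_deriv.1 hw).2
  ext i j
  simp only [hess_apply, pd_comp_inner hw, Matrix.smul_apply, Matrix.vecMulVec_apply, smul_eq_mul]
  rw [pd_const_mul (contDiff_comp_inner hw' k), pd_comp_inner hw']
  ring

/-- A smooth function that is bounded together with its partial derivatives of order one
and two. -/
structure BoundedSmooth (f : Plane → ℝ) : Prop where
  contDiff : ContDiff ℝ ∞ f
  bounded : ∃ M, ∀ x, |f x| ≤ M
  bounded_pd : ∀ i, ∃ M, ∀ x, |pd i f x| ≤ M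
  bounded_pd_pd : ∀ i j, ∃ M, ∀ x, |pd j (pd i f) x| ≤ M

theorem BoundedSmooth.exists_bound (hf : BoundedSmooth f) :
    ∃ M, 0 ≤ M ∧ ∀ x, |f x| ≤ M ∧ (∀ i, |pd i f x| ≤ M) ∧ ∀ i j, |pd j (pd i f) x| ≤ M := by
  obtain ⟨M₀, h₀⟩ := hf.bounded
  choose M₁ h₁ using hf.bounded_pd
  choose M₂ h₂ using hf.bounded_pd_pd
  have hn₀ : 0 ≤ M₀ := (abs_nonneg _).trans (h₀ 0)
  have hn₁ : ∀ i, 0 ≤ M₁ i := fun i => (abs_nonneg _).trans (h₁ i 0)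
  have hn₂ : ∀ i j, 0 ≤ M₂ i j := fun i j => (abs_nonneg _).trans (h₂ i j 0)
  have hs₁ : 0 ≤ ∑ i, M₁ i := Finset.sum_nonneg fun i _ => hn₁ i
  have hs₂ : 0 ≤ ∑ i, ∑ j, M₂ i j :=
    Finset.sum_nonneg fun i _ => Finset.sum_nonneg fun j _ => hn₂ i j
  refine ⟨M₀ + ∑ i, M₁ i + ∑ i, ∑ j, M₂ i j, by positivity, fun x => ⟨?_, fun i => ?_,
    fun i j => ?_⟩⟩
  · linarith [h₀ x]
  · linarith [h₁ i x, Finset.single_le_sum (fun i _ => hn₁ i) (Finset.mem_univ i)]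
  · linarith [h₂ i j x, Finset.single_le_sum (fun j _ => hn₂ i j) (Finset.mem_univ j),
      Finset.single_le_sum (f := fun i => ∑ j, M₂ i j)
        (fun i _ => Finset.sum_nonneg fun j _ => hn₂ i j) (Finset.mem_univ i)]

theorem BoundedSmooth.of_hasCompactSupport (hf : ContDiff ℝ ∞ f) (hc : HasCompactSupport f) :
    BoundedSmooth f := by
  have hpd : ∀ {g : Plane → ℝ}, HasCompactSupport g → ∀ i, HasCompactSupport (pd i g) :=
    fun hg i => hg.fderiv_apply ℝ _
  have hb : ∀ {g : Plane → ℝ}, ContDiff ℝ ∞ g → HasCompactSupport g → ∃ M, ∀ x, |g x| ≤ M :=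
    fun hg hgc => hg.continuous.bounded_above_of_compact_support hgc
  exact ⟨hf, hb hf hc, fun i => hb (contDiff_pd hf i) (hpd hc i),
    fun i j => hb (contDiff_pd (contDiff_pd hf i) j) (hpd (hpd hc i) j)⟩

theorem hasCompactSupport_hess (hc : HasCompactSupport f) : HasCompactSupport (hess f) := by
  have hpd : ∀ {g : Plane → ℝ} (i : Fin 2), tsupport (pd i g) ⊆ tsupport g :=
    fun i => tsupport_fderiv_apply_subset ℝ _
  refine HasCompactSupport.intro hc fun x hx => ?_
  ext i j
  rw [hess_apply]
  exact image_eq_zero_of_notMem_tsupport fun h => hx (hpd i (hpd j h))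

/-- Rapid oscillation: the Hessian of `N⁻² χ(x) f(N x + z)` is `χ(x) (D²f)(N x + z)`, up to an error
of order `N⁻¹` that is uniform in `x` and in the phase `z`. -/
theorem exists_norm_hess_oscillation_le {χ : Plane → ℝ} (hχ : BoundedSmooth χ)
    (hf : BoundedSmooth f) :
    ∃ M, 0 ≤ M ∧ ∀ (N : ℝ) (z x : Plane), 1 ≤ N →
      ‖hess (fun x => (N ^ 2)⁻¹ * (χ x * f (N • x + z))) x - χ x • hess f (N • x + z)‖
        ≤ M / N := by
  obtain ⟨A, hA0, hA⟩ := hχ.exists_bound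
  obtain ⟨B, hB0, hB⟩ := hf.exists_bound
  refine ⟨3 * (A * B), by positivity, fun N z x hN => ?_⟩
  have hN0 : 0 < N := by linarith
  refine (Matrix.norm_le_iff (by positivity)).2 fun i j => ?_
  have hosc := contDiff_comp_affine hf.contDiff N z
  have hosci := contDiff_comp_affine (contDiff_pd hf.contDiff i) N z
  have hχi := contDiff_pd hχ.contDiff i
  have e : hess (fun x => (N ^ 2)⁻¹ * (χ x * f (N • x + z))) x i j
      - χ x * pd j (pd i f) (N • x + z) =
      pd j (pd i χ) x * f (N • x + z) / N ^ 2 + (pd i χ x * pd j f (N • x + z)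
        + pd j χ x * pd i f (N • x + z)) / N := by
    rw [hess_apply, pd_const_mul (hχ.contDiff.mul hosc), pd_mul hχ.contDiff hosc,
      pd_comp_affine hf.contDiff,
      pd_const_mul ((hχ.contDiff.mul (contDiff_const.mul hosci)).add (hosc.mul hχi)),
      pd_add (hχ.contDiff.mul (contDiff_const.mul hosci)) (hosc.mul hχi),
      pd_mul hχ.contDiff (contDiff_const.mul hosci), pd_mul hosc hχi, pd_const_mul hosci,
      pd_comp_affine hf.contDiff, pd_comp_affine (contDiff_pd hf.contDiff i)]
    field_simp
    ring
  have hprod : ∀ {a b : ℝ}, |a| ≤ A → |b| ≤ B → |a * b| ≤ A * B := fun ha hb => by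
    rw [abs_mul]
    exact mul_le_mul ha hb (abs_nonneg _) hA0
  obtain ⟨-, hA1, hA2⟩ := hA x
  obtain ⟨hB0', hB1, -⟩ := hB (N • x + z)
  rw [Matrix.sub_apply, Matrix.smul_apply, smul_eq_mul, hess_apply f, e, Real.norm_eq_abs]
  have t1 : |pd j (pd i χ) x * f (N • x + z) / N ^ 2| ≤ A * B / N := by
    rw [abs_div, abs_of_pos (by positivity : (0 : ℝ) < N ^ 2)]
    exact div_le_div₀ (by positivity) (hprod (hA2 i j) hB0') hN0 (by nlinarith)
  have t2 : |(pd i χ x * pd j f (N • x + z) + pd j χ x * pd i f (N • x + z)) / N|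
      ≤ 2 * (A * B) / N := by
    rw [abs_div, abs_of_pos hN0]
    refine div_le_div_of_nonneg_right ?_ hN0.le
    refine (abs_add_le _ _).trans ?_
    linarith [hprod (hA1 i) (hB1 j), hprod (hA1 j) (hB1 i)]
  calc _ ≤ A * B / N + 2 * (A * B) / N := (abs_add_le _ _).trans (add_le_add t1 t2)
    _ = 3 * (A * B) / N := by ring

end Calculus

/-! ### Periodic functions and their means -/

section Periodic

/-- Functions on the plane with the period lattice `ℤ²`. -/
def IsPeriodic {α : Type*} (f : Plane → α) : Prop :=
  ∀ (i : Fin 2) (x : Plane), f (x + EuclideanSpace.single i 1) = f x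

/-- The uniform probability measure on the unit cell. -/
noncomputable def cell : Measure Plane :=
  (volume.restrict (Ioc (0 : ℝ) 1 ×ˢ Ioc (0 : ℝ) 1)).map fun z => !₂[z.1, z.2]

theorem continuous_toPlane : Continuous fun z : ℝ × ℝ => (!₂[z.1, z.2] : Plane) := by
  refine (PiLp.continuous_toLp 2 _).comp (continuous_pi fun i => ?_)
  fin_cases i
  · exact continuous_fst
  · exact continuous_snd

instance : IsProbabilityMeasure cell := by
  have : IsProbabilityMeasure (volume.restrict (Ioc (0 : ℝ) 1 ×ˢ Ioc (0 : ℝ) 1)) :=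
    ⟨by simp [Measure.volume_eq_prod, Measure.prod_prod]⟩
  exact Measure.isProbabilityMeasure_map continuous_toPlane.aemeasurable

theorem isPeriodic_fst {α : Type*} {f : Plane → α} (hf : IsPeriodic f) (t : ℝ) :
    Function.Periodic (fun s => f !₂[s, t]) 1 := fun s => by
  refine Eq.trans (congrArg f ?_) (hf 0 !₂[s, t])
  ext i
  fin_cases i <;> simp

theorem isPeriodic_snd {α : Type*} {f : Plane → α} (hf : IsPeriodic f) (s : ℝ) :
    Function.Periodic (fun t => f !₂[s, t]) 1 := fun t => by
  refine Eq.trans (congrArg f ?_) (hf 1 !₂[s, t])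
  ext i
  fin_cases i <;> simp

theorem eq_toPlane (x : Plane) : x = !₂[x 0, x 1] := by
  ext i
  fin_cases i <;> simp

theorem IsPeriodic.exists_bound {f : Plane → ℝ} (hf : IsPeriodic f) (hc : Continuous f) :
    ∃ M, ∀ x, |f x| ≤ M := by
  obtain ⟨M, hM⟩ := (isCompact_Icc.prod isCompact_Icc :
    IsCompact (Icc (0 : ℝ) 1 ×ˢ Icc (0 : ℝ) 1)).exists_bound_of_continuousOn
      (hc.comp continuous_toPlane).continuousOn
  refine ⟨M, fun x => ?_⟩
  obtain ⟨s, hs, hs'⟩ := (isPeriodic_fst hf (x 1)).exists_mem_Ico₀ one_pos (x 0)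
  obtain ⟨t, ht, ht'⟩ := (isPeriodic_snd hf s).exists_mem_Ico₀ one_pos (x 1)
  have h := hM (s, t) ⟨Ico_subset_Icc_self hs, Ico_subset_Icc_self ht⟩
  simp only [Function.comp_apply, Real.norm_eq_abs] at h hs' ht'
  rw [eq_toPlane x, hs', ht']
  exact h

theorem IsPeriodic.pd {f : Plane → ℝ} (hf : IsPeriodic f) (i : Fin 2) : IsPeriodic (pd i f) := by
  intro j x
  have h : (fun y => f (y + EuclideanSpace.single j 1)) = f := funext (hf j)
  unfold OrnsteinPlane.pd
  rw [← fderiv_comp_add_right, h]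

theorem IsPeriodic.hess {f : Plane → ℝ} (hf : IsPeriodic f) : IsPeriodic (hess f) := by
  intro i x
  ext j l
  exact (hf.pd j).pd l i x

theorem IsPeriodic.boundedSmooth {f : Plane → ℝ} (hf : IsPeriodic f) (hc : ContDiff ℝ ∞ f) :
    BoundedSmooth f :=
  ⟨hc, hf.exists_bound hc.continuous, fun i => (hf.pd i).exists_bound (contDiff_pd hc i).continuous,
    fun i j => ((hf.pd i).pd j).exists_bound (contDiff_pd (contDiff_pd hc i) j).continuous⟩

theorem integral_cell {f : Plane → ℝ} (hf : Continuous f) :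
    ∫ x, f x ∂cell = ∫ s in (0 : ℝ)..1, ∫ t in (0 : ℝ)..1, f !₂[s, t] := by
  have hc := hf.comp continuous_toPlane
  rw [cell, integral_map continuous_toPlane.aemeasurable hf.aestronglyMeasurable,
    Measure.volume_eq_prod, setIntegral_prod]
  · simp only [intervalIntegral.integral_of_le zero_le_one]
  · exact (hc.continuousOn.integrableOn_compact (isCompact_Icc.prod isCompact_Icc)).mono_set
      (prod_mono Ioc_subset_Icc_self Ioc_subset_Icc_self)

/-- The mean of a periodic function is invariant under translations. -/
theorem IsPeriodic.integral_cell_add {f : Plane → ℝ} (hf : IsPeriodic f) (hc : Continuous f)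
    (y : Plane) : ∫ x, f (y + x) ∂cell = ∫ x, f x ∂cell := by
  have hshift : ∀ {p : ℝ → ℝ}, Function.Periodic p 1 → ∀ a : ℝ,
      ∫ s in (0 : ℝ)..1, p (a + s) = ∫ s in (0 : ℝ)..1, p s := by
    intro p hp a
    rw [intervalIntegral.integral_comp_add_left, add_zero]
    simpa using hp.intervalIntegral_add_eq a 0
  have hadd : ∀ s t : ℝ, y + !₂[s, t] = !₂[y 0 + s, y 1 + t] := fun s t => by
    ext i
    fin_cases i <;> simp
  rw [integral_cell hc, integral_cell (f := fun x => f (y + x)) (hc.comp (continuous_const_add y))]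
  simp only [hadd]
  simp only [fun s => hshift (isPeriodic_snd hf s) (y 1)]
  refine hshift (p := fun s => ∫ t in (0 : ℝ)..1, f !₂[s, t]) (fun s => ?_) (y 0)
  exact intervalIntegral.integral_congr fun t _ => isPeriodic_fst hf t s

theorem integrable_of_bound {X : Type*} [TopologicalSpace X] [MeasurableSpace X]
    [OpensMeasurableSpace X] [SecondCountableTopology X] {ν : Measure X} [IsFiniteMeasure ν]
    {f : X → ℝ} (hf : Continuous f) (hb : ∃ M, ∀ x, |f x| ≤ M) : Integrable f ν :=
  Integrable.of_bound hf.aestronglyMeasurable hb.choose (Eventually.of_forall hb.choose_spec)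

/-- Averaging over the phase `z` separates the slow variable `x` from the fast variable
`N • x + z`. Hence a lower bound for two-scale integrals that holds for all phases passes to
the means of the periodic factors. -/
theorem le_of_forall_le_integral_oscillation {ν : Measure Plane} [IsFiniteMeasure ν]
    {a b f g : Plane → ℝ} (ha : Continuous a) (ha' : ∃ M, ∀ x, |a x| ≤ M)
    (hb : Continuous b) (hb' : ∃ M, ∀ x, |b x| ≤ M)
    (hf : Continuous f) (hf' : IsPeriodic f) (hg : Continuous g) (hg' : IsPeriodic g)
    {N c : ℝ} (h : ∀ z, c ≤ ∫ x, (a x * f (N • x + z) + b x * g (N • x + z)) ∂ν) :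
    c ≤ (∫ x, a x ∂ν) * (∫ z, f z ∂cell) + (∫ x, b x ∂ν) * ∫ z, g z ∂cell := by
  obtain ⟨A, hA⟩ := ha'
  obtain ⟨B, hB⟩ := hb'
  obtain ⟨F, hF⟩ := hf'.exists_bound hf
  obtain ⟨G, hG⟩ := hg'.exists_bound hg
  have hbound : ∀ x z, |a x * f (N • x + z) + b x * g (N • x + z)| ≤ A * F + B * G := by
    intro x z
    refine (abs_add_le _ _).trans (add_le_add ?_ ?_) <;> rw [abs_mul]
    · exact mul_le_mul (hA x) (hF _) (abs_nonneg _) ((abs_nonneg _).trans (hA x))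
    · exact mul_le_mul (hB x) (hG _) (abs_nonneg _) ((abs_nonneg _).trans (hB x))
  have hint : Integrable (fun p : Plane × Plane =>
      a p.2 * f (N • p.2 + p.1) + b p.2 * g (N • p.2 + p.1)) (cell.prod ν) :=
    integrable_of_bound (by fun_prop) ⟨_, fun p => hbound p.2 p.1⟩
  have hmean : ∀ x, ∫ z, (a x * f (N • x + z) + b x * g (N • x + z)) ∂cell =
      a x * (∫ z, f z ∂cell) + b x * ∫ z, g z ∂cell := by
    intro x
    rw [integral_add, integral_const_mul, integral_const_mul, hf'.integral_cell_add hf,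
      hg'.integral_cell_add hg]
    · exact (integrable_of_bound (by fun_prop) ⟨F, fun z => hF _⟩).const_mul _
    · exact (integrable_of_bound (by fun_prop) ⟨G, fun z => hG _⟩).const_mul _
  calc c = ∫ _z, c ∂cell := by simp
    _ ≤ ∫ z, ∫ x, (a x * f (N • x + z) + b x * g (N • x + z)) ∂ν ∂cell :=
      integral_mono (integrable_const _) hint.integral_prod_left h
    _ = ∫ x, ∫ z, (a x * f (N • x + z) + b x * g (N • x + z)) ∂cell ∂ν :=
      integral_integral_swap hint
    _ = ∫ x, (a x * (∫ z, f z ∂cell) + b x * ∫ z, g z ∂cell) ∂ν := by simp only [hmean]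
    _ = _ := by
      rw [integral_add, integral_mul_const, integral_mul_const]
      · exact (integrable_of_bound ha ⟨A, hA⟩).mul_const _
      · exact (integrable_of_bound hb ⟨B, hB⟩).mul_const _

end Periodic

/-! ### One-dimensional lamination profiles -/

section Profile

theorem contDiff_sigmoid : ContDiff ℝ ∞ Real.sigmoid :=
  contDiff_iff_contDiffAt.2 fun _ => analyticAt_sigmoid.contDiffAt

theorem exists_periodic_antideriv {p : ℝ → ℝ} (hp : ContDiff ℝ ∞ p)
    (hper : Function.Periodic p 1) (hmean : ∫ s in (0 : ℝ)..1, p s = 0) :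
    ∃ q : ℝ → ℝ, ContDiff ℝ ∞ q ∧ Function.Periodic q 1 ∧ ∫ s in (0 : ℝ)..1, q s = 0 ∧
      deriv q = p := by
  have hint : ∀ a b, IntervalIntegrable p volume a b := fun a b =>
    hp.continuous.intervalIntegrable a b
  set P : ℝ → ℝ := fun s => ∫ t in (0 : ℝ)..s, p t with hP
  have hd : ∀ s, HasDerivAt P (p s) s := fun s =>
    intervalIntegral.integral_hasDerivAt_right (hint 0 s)
      hp.continuous.stronglyMeasurable.stronglyMeasurableAtFilter hp.continuous.continuousAt
  have hd' : ∀ c s, HasDerivAt (fun s => P s - c) (p s) s := fun c s => (hd s).sub_const c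
  have hPc : Continuous P := continuous_iff_continuousAt.2 fun s => (hd s).continuousAt
  have hderiv : deriv (fun s => P s - ∫ t in (0 : ℝ)..1, P t) = p :=
    funext fun s => (hd' _ s).deriv
  refine ⟨fun s => P s - ∫ t in (0 : ℝ)..1, P t, ?_, fun s => ?_, ?_, hderiv⟩
  · exact contDiff_infty_iff_deriv.2 ⟨fun s => (hd' _ s).differentiableAt, hderiv ▸ hp⟩
  · have h : P (s + 1) = P s := by
      rw [hP]
      simp only
      rw [← intervalIntegral.integral_add_adjacent_intervals (hint 0 s) (hint s (s + 1)),
        hper.intervalIntegral_add_eq s 0, zero_add, hmean, add_zero]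
    simp only [h]
  · rw [intervalIntegral.integral_sub (hPc.intervalIntegrable _ _) (by simp)]
    simp

theorem integral_eq_half {η : ℝ → ℝ} (hη : Continuous η) (hper : Function.Periodic η 1)
    (hsymm : ∀ s, η (s + 1 / 2) = 1 - η s) : ∫ s in (0 : ℝ)..1, η s = 1 / 2 := by
  have h1 : ∫ s in (0 : ℝ)..1, η (s + 1 / 2) = ∫ s in (0 : ℝ)..1, η s := by
    rw [intervalIntegral.integral_comp_add_right]
    have := hper.intervalIntegral_add_eq (0 + 1 / 2) 0
    rwa [show (0 : ℝ) + 1 / 2 + 1 = 1 + 1 / 2 by ring, zero_add 1] at this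
  simp only [hsymm] at h1
  rw [intervalIntegral.integral_sub (by simp) (hη.intervalIntegrable _ _)] at h1
  simp only [intervalIntegral.integral_const, sub_zero, one_smul] at h1
  linarith

theorem tendsto_sigmoid_mul_one_sub {a : ℝ} (ha : a ≠ 0) :
    Tendsto (fun n : ℕ => Real.sigmoid (n * a) * (1 - Real.sigmoid (n * a))) atTop (𝓝 0) := by
  have hcast : Tendsto (fun n : ℕ => (n : ℝ)) atTop atTop := tendsto_natCast_atTop_atTop
  rcases ha.lt_or_gt with ha | ha
  · have h := Real.tendsto_sigmoid_atBot.comp (hcast.atTop_mul_const_of_neg ha)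
    simpa using h.mul (h.const_sub 1)
  · have h := Real.tendsto_sigmoid_atTop.comp (hcast.atTop_mul_const ha)
    simpa using h.mul (h.const_sub 1)

/-- A smooth periodic approximation `η` of the indicator function of a half-period, together with
a periodic `w` such that `w'' = 2 η - 1`. The last property says that `η` is close to the
values `0` and `1`. -/
theorem exists_profile {ε : ℝ} (hε : 0 < ε) :
    ∃ η w : ℝ → ℝ, ContDiff ℝ ∞ η ∧ Function.Periodic η 1 ∧ ContDiff ℝ ∞ w ∧
      Function.Periodic w 1 ∧ (∀ s, 0 ≤ η s) ∧ (∀ s, η s ≤ 1) ∧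
      (∫ s in (0 : ℝ)..1, η s = 1 / 2) ∧ (∀ s, deriv (deriv w) s = 2 * η s - 1) ∧
      ∫ s in (0 : ℝ)..1, η s * (1 - η s) < ε := by
  have hsmooth : ∀ n : ℕ, ContDiff ℝ ∞
      fun s : ℝ => Real.sigmoid (n * Real.sin (2 * Real.pi * s)) := fun n =>
    contDiff_sigmoid.comp
      (contDiff_const.mul (Real.contDiff_sin.comp (contDiff_const.mul contDiff_id)))
  -- The profiles are sharp off the zeros of the sine, which form a countable set.
  have hlim : Tendsto (fun n : ℕ => ∫ s in (0 : ℝ)..1,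
      Real.sigmoid (n * Real.sin (2 * Real.pi * s)) *
        (1 - Real.sigmoid (n * Real.sin (2 * Real.pi * s)))) atTop (𝓝 0) := by
    have h := intervalIntegral.tendsto_integral_filter_of_dominated_convergence
      (μ := volume) (a := 0) (b := 1) (l := atTop) (f := fun _ : ℝ => (0 : ℝ))
      (F := fun (n : ℕ) (s : ℝ) => Real.sigmoid (n * Real.sin (2 * Real.pi * s)) *
        (1 - Real.sigmoid (n * Real.sin (2 * Real.pi * s)))) (fun _ => (1 : ℝ))
      (Eventually.of_forall fun n => ((hsmooth n).continuous.mul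
        (continuous_const.sub (hsmooth n).continuous)).aestronglyMeasurable)
      (Eventually.of_forall fun n => Eventually.of_forall fun s _ => ?_) (by simp) ?_
    · simpa using h
    · have h0 := Real.sigmoid_nonneg (n * Real.sin (2 * Real.pi * s))
      have h1 := Real.sigmoid_le_one (n * Real.sin (2 * Real.pi * s))
      rw [Real.norm_of_nonneg (mul_nonneg h0 (sub_nonneg.2 h1))]
      nlinarith
    · have hnull : ∀ᵐ s : ℝ, s ∉ Set.range fun n : ℤ => (n : ℝ) / 2 :=
        (Set.countable_range _).ae_notMem _
      filter_upwards [hnull] with s hs _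
      refine tendsto_sigmoid_mul_one_sub fun h0 => hs ?_
      obtain ⟨n, hn⟩ := Real.sin_eq_zero_iff.1 h0
      refine ⟨n, ?_⟩
      have := Real.pi_pos
      simp only
      field_simp
      nlinarith
  obtain ⟨n, hn⟩ := (hlim.eventually (gt_mem_nhds hε)).exists
  -- Since the sine changes sign under a shift by half a period, `η` turns into `1 - η`.
  set η : ℝ → ℝ := fun s => Real.sigmoid (n * Real.sin (2 * Real.pi * s)) with hη
  have hηs : ContDiff ℝ ∞ η := hsmooth n
  have hper : Function.Periodic η 1 := fun s => by
    simp only [hη, mul_add, mul_one, Real.sin_add_two_pi]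
  have hhalf : ∫ s in (0 : ℝ)..1, η s = 1 / 2 := by
    refine integral_eq_half hηs.continuous hper fun s => ?_
    simp only [hη]
    rw [show 2 * Real.pi * (s + 1 / 2) = 2 * Real.pi * s + Real.pi by ring, Real.sin_add_pi,
      mul_neg, Real.sigmoid_neg]
  obtain ⟨q, hq, hqper, hqmean, hq'⟩ :=
    exists_periodic_antideriv (p := fun s => 2 * η s - 1)
      ((contDiff_const.mul hηs).sub contDiff_const)
      (fun s => by simp only [hper s]) (by
        rw [intervalIntegral.integral_sub ((hηs.continuous.const_mul 2).intervalIntegrable _ _)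
          (by simp), intervalIntegral.integral_const_mul, hhalf]
        simp)
  obtain ⟨w, hw, hwper, -, hw'⟩ := exists_periodic_antideriv hq hqper hqmean
  exact ⟨η, w, hηs, hper, hw, hwper, fun s => Real.sigmoid_nonneg _, fun s => Real.sigmoid_le_one _,
    hhalf, fun s => by rw [hw', hq'], hn⟩

end Profile

/-! ### The periodic quasiconvex envelope -/

section Envelope

/-- The covector `(m, 1)`. For integral `m` its plane waves have the period lattice `ℤ²`. -/
noncomputable def waveVector (m : ℤ) : Plane := !₂[(m : ℝ), 1]

theorem isPeriodic_wave {p : ℝ → ℝ} (hp : Function.Periodic p 1) (m : ℤ) :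
    IsPeriodic fun x : Plane => p (inner ℝ (waveVector m) x) := by
  intro i x
  fin_cases i
  · simpa [inner_add_right, EuclideanSpace.inner_single_right, waveVector] using
      hp.int_mul m (inner ℝ (waveVector m) x)
  · simpa [inner_add_right, EuclideanSpace.inner_single_right, waveVector] using
      hp (inner ℝ (waveVector m) x)

theorem integral_cell_wave {p : ℝ → ℝ} (hp : Function.Periodic p 1) (hc : Continuous p) (m : ℤ) :
    ∫ x, p (inner ℝ (waveVector m) x) ∂cell = ∫ s in (0 : ℝ)..1, p s := by
  rw [integral_cell (f := fun x => p (inner ℝ (waveVector m) x)) (by fun_prop)]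
  have h : ∀ s : ℝ, ∫ t in (0 : ℝ)..1, p (inner ℝ (waveVector m) !₂[s, t]) =
      ∫ t in (0 : ℝ)..1, p t := by
    intro s
    have e : ∀ t : ℝ, inner ℝ (waveVector m) !₂[s, t] = s * m + t := fun t => by
      simp [waveVector, PiLp.inner_apply, Fin.sum_univ_two]
    simp only [e]
    rw [intervalIntegral.integral_comp_add_left, add_zero]
    simpa using hp.intervalIntegral_add_eq (s * m) 0
  simp [h]

theorem IsPeriodic.comp_natCast_smul_add {α : Type*} {f : Plane → α} (hf : IsPeriodic f) (N : ℕ)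
    (z : Plane) : IsPeriodic fun x => f ((N : ℝ) • x + z) := by
  have h : ∀ (n : ℕ) (i : Fin 2) (x : Plane),
      f (x + (n : ℝ) • EuclideanSpace.single i 1) = f x := by
    intro n i x
    induction n with
    | zero => simp
    | succ n ih =>
      rw [← ih, ← hf i (x + (n : ℝ) • EuclideanSpace.single i 1), Nat.cast_succ]
      congr 1
      module
  intro i x
  simp only
  rw [← h N i ((N : ℝ) • x + z)]
  congr 1
  module

/-- Smooth `ℤ²`-periodic functions on the plane. -/
abbrev PeriodicPotential : Type := {f : Plane → ℝ // ContDiff ℝ ∞ f ∧ IsPeriodic f}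

instance : Inhabited PeriodicPotential := ⟨⟨fun _ => 0, contDiff_const, fun _ _ => rfl⟩⟩

/-- The mean of `h` along the Hessian field `X + D²f`. -/
noncomputable def energy (h : Mat → ℝ) (X : Mat) (f : PeriodicPotential) : ℝ :=
  ∫ x, h (X + hess f.1 x) ∂cell

/-- The quasiconvex envelope of `h` with respect to Hessians of periodic functions. -/
noncomputable def envelope (h : Mat → ℝ) (X : Mat) : ℝ :=
  ⨅ f : PeriodicPotential, energy h X f

variable {h : Mat → ℝ} {L : ℝ}

theorem continuous_add_hess (X : Mat) (f : PeriodicPotential) :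
    Continuous fun x => X + hess f.1 x :=
  continuous_const.add (continuous_hess f.2.1)

theorem isPeriodic_comp_add_hess (h : Mat → ℝ) (X : Mat) (f : PeriodicPotential) :
    IsPeriodic fun x => h (X + hess f.1 x) := fun i x => by
  simp only [f.2.2.hess i x]

theorem LipschitzHomogeneous.integrable_energy (hh : LipschitzHomogeneous L h) (X : Mat)
    (f : PeriodicPotential) : Integrable (fun x => h (X + hess f.1 x)) cell :=
  have hc := hh.continuous.comp (continuous_add_hess X f)
  integrable_of_bound hc ((isPeriodic_comp_add_hess h X f).exists_bound hc)

theorem LipschitzHomogeneous.energy_le_add (hh : LipschitzHomogeneous L h) (X Y : Mat)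
    (f : PeriodicPotential) : energy h X f ≤ energy h Y f + L * ‖X - Y‖ := by
  have e : energy h Y f + L * ‖X - Y‖ = ∫ x, (h (Y + hess f.1 x) + L * ‖X - Y‖) ∂cell := by
    rw [integral_add (hh.integrable_energy Y f) (integrable_const _)]
    simp [energy]
  rw [e]
  refine integral_mono (hh.integrable_energy X f)
    ((hh.integrable_energy Y f).add (integrable_const _)) fun x => hh.le_add ?_
  rw [add_sub_add_right_eq_sub]

theorem LipschitzHomogeneous.bddBelow_energy (hh : LipschitzHomogeneous L h)
    (h0 : ∀ f, 0 ≤ energy h 0 f) (X : Mat) : BddBelow (Set.range (energy h X)) := by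
  refine ⟨-(L * ‖0 - X‖), ?_⟩
  rintro _ ⟨f, rfl⟩
  linarith [hh.energy_le_add 0 X f, h0 f]

theorem LipschitzHomogeneous.envelope_le (hh : LipschitzHomogeneous L h)
    (h0 : ∀ f, 0 ≤ energy h 0 f) (X : Mat) (f : PeriodicPotential) :
    envelope h X ≤ energy h X f :=
  ciInf_le (hh.bddBelow_energy h0 X) f

theorem hess_zero (x : Plane) : hess (fun _ => 0) x = 0 := by
  have h : ∀ i, pd i (fun _ => 0) = fun _ => 0 := fun i => by
    funext x
    simp [pd]
  ext i j
  simp [hess_apply, h]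

theorem LipschitzHomogeneous.envelope_le_self (hh : LipschitzHomogeneous L h)
    (h0 : ∀ f, 0 ≤ energy h 0 f) (X : Mat) : envelope h X ≤ h X := by
  refine (hh.envelope_le h0 X default).trans_eq ?_
  have : ∀ x, hess (default : PeriodicPotential).1 x = 0 := hess_zero
  simp [energy, this]

theorem LipschitzHomogeneous.lipschitzHomogeneous_envelope (hh : LipschitzHomogeneous L h)
    (h0 : ∀ f, 0 ≤ energy h 0 f) : LipschitzHomogeneous L (envelope h) := by
  have hle : ∀ X Y, envelope h X ≤ envelope h Y + L * ‖X - Y‖ := by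
    intro X Y
    rw [← sub_le_iff_le_add]
    refine le_ciInf fun f => ?_
    linarith [hh.envelope_le h0 X f, hh.energy_le_add X Y f]
  have hsm : ∀ (t : ℝ) (X : Mat), 0 < t →
      envelope h (t • X) ≤ t * envelope h X := by
    intro t X ht
    rw [mul_comm, ← div_le_iff₀ ht]
    refine le_ciInf fun f => ?_
    rw [div_le_iff₀ ht]
    refine (hh.envelope_le h0 _ ⟨fun x => t * f.1 x, contDiff_const.mul f.2.1,
      fun i x => by simp only [f.2.2 i x]⟩).trans_eq ?_
    simp only [energy, hess_const_mul f.2.1, ← smul_add, hh.map_smul t _ ht]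
    rw [integral_const_mul, mul_comm]
  refine ⟨hh.nonneg, fun X Y => abs_le.2 ⟨?_, ?_⟩, fun t X ht => le_antisymm (hsm t X ht) ?_⟩
  · have := hle Y X
    rw [norm_sub_rev] at this
    linarith
  · linarith [hle X Y]
  · have := hsm t⁻¹ (t • X) (inv_pos.2 ht)
    rw [smul_smul, inv_mul_cancel₀ ht.ne', one_smul] at this
    rwa [← le_inv_mul_iff₀ ht]

theorem le_of_forall_le_add_div {a b K : ℝ} (h : ∀ N : ℕ, 1 ≤ N → a ≤ b + K / N) : a ≤ b := by
  have hlim : Tendsto (fun N : ℕ => b + K / N) atTop (𝓝 (b + 0)) :=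
    (tendsto_const_div_atTop_nhds_zero_nat K).const_add b
  rw [add_zero] at hlim
  exact ge_of_tendsto hlim (eventually_atTop.2 ⟨1, h⟩)

/-- The key construction. A coarse plane wave splits `X` into `X ± s (k ⊗ k)` on alternating
stripes; on these stripes, rapidly oscillating copies of `f₁` and `f₂` are superposed. -/
theorem LipschitzHomogeneous.two_mul_envelope_le (hh : LipschitzHomogeneous L h)
    (h0 : ∀ f, 0 ≤ energy h 0 f) (m : ℤ) (X : Mat) (s : ℝ) (f₁ f₂ : PeriodicPotential) :
    2 * envelope h X ≤
      energy h (X + s • Matrix.vecMulVec (waveVector m) (waveVector m)) f₁ +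
        energy h (X - s • Matrix.vecMulVec (waveVector m) (waveVector m)) f₂ := by
  set k := waveVector m with hk
  set K : Mat := Matrix.vecMulVec k k
  obtain ⟨D, hD⟩ : ∃ D, ∀ x, |‖X + s • K + hess f₁.1 x - (X - s • K + hess f₂.1 x)‖| ≤ D :=
    IsPeriodic.exists_bound (fun i x => by simp only [f₁.2.2.hess i x, f₂.2.2.hess i x])
      ((continuous_add_hess (X + s • K) f₁).sub (continuous_add_hess (X - s • K) f₂)).norm
  simp only [abs_norm] at hD
  have hD0 : 0 ≤ D := (norm_nonneg _).trans (hD 0)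
  refine le_of_forall_pos_le_add fun ε hε => ?_
  obtain ⟨η, w, hη, hηper, hw, hwper, hη0, hη1, hηhalf, hw'', hηint⟩ :=
    exists_profile (ε := ε / (4 * L * D + 1)) (div_pos hε (by have := hh.nonneg; positivity))
  have hηs := contDiff_comp_inner hη k
  have hηp := isPeriodic_wave hηper m
  have hηs' : ContDiff ℝ ∞ fun x : Plane => 1 - η (inner ℝ k x) := contDiff_const.sub hηs
  have hηp' : IsPeriodic fun x : Plane => 1 - η (inner ℝ k x) := fun i x => by
    simp only [show η (inner ℝ k (x + EuclideanSpace.single i 1)) = η (inner ℝ k x) from hηp i x]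
  have hwp := isPeriodic_wave hwper m
  obtain ⟨M₁, -, hM₁⟩ := exists_norm_hess_oscillation_le (hηp.boundedSmooth hηs)
    (f₁.2.2.boundedSmooth f₁.2.1)
  obtain ⟨M₂, -, hM₂⟩ := exists_norm_hess_oscillation_le (hηp'.boundedSmooth hηs')
    (f₂.2.2.boundedSmooth f₂.2.1)
  set δ := ∫ s in (0 : ℝ)..1, η s * (1 - η s) with hδ
  have hmain : ∀ N : ℕ, 1 ≤ N → envelope h X ≤
      (1 / 2 * energy h (X + s • K) f₁ + 1 / 2 * energy h (X - s • K) f₂ + 2 * L * D * δ) +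
        L * (M₁ + M₂) / N := by
    intro N hN
    have hN' : (1 : ℝ) ≤ N := by exact_mod_cast hN
    -- It suffices to compare with the two-scale integral for every phase `z`.
    suffices H : ∀ z : Plane, envelope h X - 2 * L * D * δ - L * (M₁ + M₂) / N ≤
        ∫ x, (η (inner ℝ k x) * h (X + s • K + hess f₁.1 ((N : ℝ) • x + z)) +
          (1 - η (inner ℝ k x)) * h (X - s • K + hess f₂.1 ((N : ℝ) • x + z))) ∂cell by
      have := le_of_forall_le_integral_oscillation hηs.continuous (hηp.exists_bound hηs.continuous)
        hηs'.continuous (hηp'.exists_bound hηs'.continuous)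
        (hh.continuous.comp (continuous_add_hess (X + s • K) f₁)) (isPeriodic_comp_add_hess h _ f₁)
        (hh.continuous.comp (continuous_add_hess (X - s • K) f₂)) (isPeriodic_comp_add_hess h _ f₂)
        H
      have hhalf : ∫ x, η (inner ℝ k x) ∂cell = 1 / 2 := by
        rw [hk, integral_cell_wave hηper hη.continuous, hηhalf]
      rw [integral_sub (integrable_const _) (integrable_of_bound hηs.continuous
        (hηp.exists_bound hηs.continuous)), hhalf] at this
      simp only [integral_const, probReal_univ, one_smul] at this
      simp only [Function.comp_apply] at this
      simp only [energy]
      linarith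
    intro z
    set F₁ : Plane → ℝ := fun x => ((N : ℝ) ^ 2)⁻¹ * (η (inner ℝ k x) * f₁.1 ((N : ℝ) • x + z))
      with hF₁
    set F₂ : Plane → ℝ := fun x =>
      ((N : ℝ) ^ 2)⁻¹ * ((1 - η (inner ℝ k x)) * f₂.1 ((N : ℝ) • x + z)) with hF₂
    have hF₁s : ContDiff ℝ ∞ F₁ :=
      contDiff_const.mul (hηs.mul (contDiff_comp_affine f₁.2.1 N z))
    have hF₂s : ContDiff ℝ ∞ F₂ :=
      contDiff_const.mul (hηs'.mul (contDiff_comp_affine f₂.2.1 N z))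
    have hws := contDiff_comp_inner hw k
    have hsws : ContDiff ℝ ∞ fun x : Plane => s * w (inner ℝ k x) := contDiff_const.mul hws
    let Ψ : PeriodicPotential := ⟨fun x => s * w (inner ℝ k x) + (F₁ x + F₂ x),
      hsws.add (hF₁s.add hF₂s), fun i x => by
        have e₁ := f₁.2.2.comp_natCast_smul_add N z i x
        have e₂ := f₂.2.2.comp_natCast_smul_add N z i x
        have e₃ := hηp i x
        have e₄ := hwp i x
        simp only [← hk] at e₁ e₂ e₃ e₄
        simp only [hF₁, hF₂, e₁, e₂, e₃, e₄]⟩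
    have hpoint : ∀ x, h (X + hess Ψ.1 x) ≤
        (η (inner ℝ k x) * h (X + s • K + hess f₁.1 ((N : ℝ) • x + z)) +
          (1 - η (inner ℝ k x)) * h (X - s • K + hess f₂.1 ((N : ℝ) • x + z))) +
        (2 * L * D * (η (inner ℝ k x) * (1 - η (inner ℝ k x))) + L * (M₁ + M₂) / N) := by
      intro x
      set U := X + s • K + hess f₁.1 ((N : ℝ) • x + z)
      set V := X - s • K + hess f₂.1 ((N : ℝ) • x + z)
      have hhess : hess Ψ.1 x =
          s • (2 * η (inner ℝ k x) - 1) • K + (hess F₁ x + hess F₂ x) := by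
        rw [hess_add hsws (hF₁s.add hF₂s), hess_add hF₁s hF₂s, hess_const_mul hws,
          hess_comp_inner hw, hw'']
      have hclose : ‖(X + hess Ψ.1 x) -
          (η (inner ℝ k x) • U + (1 - η (inner ℝ k x)) • V)‖ ≤ (M₁ + M₂) / N := by
        have e : (X + hess Ψ.1 x) - (η (inner ℝ k x) • U + (1 - η (inner ℝ k x)) • V) =
            (hess F₁ x - η (inner ℝ k x) • hess f₁.1 ((N : ℝ) • x + z)) +
            (hess F₂ x - (1 - η (inner ℝ k x)) • hess f₂.1 ((N : ℝ) • x + z)) := by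
          rw [hhess]
          module
        rw [e, add_div]
        exact (norm_add_le _ _).trans (add_le_add (hM₁ N z x hN') (hM₂ N z x hN'))
      have h1 := hh.le_add hclose
      have h2 := hh.map_segment_le (hη0 (inner ℝ k x)) (hη1 (inner ℝ k x)) U V
      have h3 : 2 * L * (η (inner ℝ k x) * (1 - η (inner ℝ k x))) * ‖U - V‖ ≤
          2 * L * (η (inner ℝ k x) * (1 - η (inner ℝ k x))) * D :=
        mul_le_mul_of_nonneg_left (hD _) (mul_nonneg (mul_nonneg zero_le_two hh.nonneg)
          (mul_nonneg (hη0 _) (sub_nonneg.2 (hη1 _))))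
      rw [mul_div_assoc]
      linarith
    have hηη : Continuous fun x : Plane => η (inner ℝ k x) * (1 - η (inner ℝ k x)) :=
      hηs.continuous.mul hηs'.continuous
    have hηηint : Integrable (fun x : Plane => η (inner ℝ k x) * (1 - η (inner ℝ k x))) cell :=
      integrable_of_bound hηη (IsPeriodic.exists_bound
        (isPeriodic_wave (p := fun s => η s * (1 - η s)) (fun s => by simp only [hηper s]) m) hηη)
    have hδ' : ∫ x, η (inner ℝ k x) * (1 - η (inner ℝ k x)) ∂cell = δ :=
      integral_cell_wave (p := fun s => η s * (1 - η s)) (fun s => by simp only [hηper s])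
        (hη.continuous.mul (continuous_const.sub hη.continuous)) m
    have hprod : ∀ {a : Plane → ℝ} {Y : Mat} (f : PeriodicPotential), Continuous a → IsPeriodic a →
        Integrable (fun x => a x * h (Y + hess f.1 ((N : ℝ) • x + z))) cell := by
      intro a Y f ha hap
      have hc : Continuous fun x => a x * h (Y + hess f.1 ((N : ℝ) • x + z)) :=
        ha.mul ((hh.continuous.comp (continuous_add_hess Y f)).comp (by fun_prop))
      refine integrable_of_bound hc (IsPeriodic.exists_bound (fun i x => ?_) hc)
      have e := (isPeriodic_comp_add_hess h Y f).comp_natCast_smul_add N z i x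
      simp only at e
      simp only [e, hap i x]
    have hi₁ := hprod (Y := X + s • K) f₁ hηs.continuous hηp
    have hi₂ := hprod (Y := X - s • K) f₂ hηs'.continuous hηp'
    have hi₁₂ : Integrable (fun x =>
        η (inner ℝ k x) * h (X + s • K + hess f₁.1 ((N : ℝ) • x + z)) +
          (1 - η (inner ℝ k x)) * h (X - s • K + hess f₂.1 ((N : ℝ) • x + z))) cell :=
      hi₁.add hi₂
    have hi₃ : Integrable (fun x =>
        2 * L * D * (η (inner ℝ k x) * (1 - η (inner ℝ k x))) + L * (M₁ + M₂) / N) cell :=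
      (hηηint.const_mul (2 * L * D)).add (integrable_const _)
    have hint := integral_mono (hh.integrable_energy X Ψ) (hi₁₂.add hi₃) hpoint
    have e : ∫ x, ((η (inner ℝ k x) * h (X + s • K + hess f₁.1 ((N : ℝ) • x + z)) +
          (1 - η (inner ℝ k x)) * h (X - s • K + hess f₂.1 ((N : ℝ) • x + z))) +
        (2 * L * D * (η (inner ℝ k x) * (1 - η (inner ℝ k x))) + L * (M₁ + M₂) / N)) ∂cell =
        ∫ x, (η (inner ℝ k x) * h (X + s • K + hess f₁.1 ((N : ℝ) • x + z)) +
          (1 - η (inner ℝ k x)) * h (X - s • K + hess f₂.1 ((N : ℝ) • x + z))) ∂cell +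
        (2 * L * D * δ + L * (M₁ + M₂) / N) := by
      rw [integral_add hi₁₂ hi₃,
        integral_add (hηηint.const_mul _) (integrable_const _), integral_const_mul, hδ']
      simp
    have hfin := (hh.envelope_le h0 X Ψ).trans (hint.trans_eq e)
    linarith
  have hfinal := le_of_forall_le_add_div hmain
  have hδε : 4 * L * D * δ ≤ ε := by
    have hpos : 0 < 4 * L * D + 1 := by have := hh.nonneg; positivity
    have hδ0 : 0 ≤ δ := intervalIntegral.integral_nonneg zero_le_one fun s _ =>
      mul_nonneg (hη0 s) (sub_nonneg.2 (hη1 s))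
    have := (lt_div_iff₀ hpos).1 hηint
    nlinarith
  linarith

theorem LipschitzHomogeneous.midconvexAlong_envelope (hh : LipschitzHomogeneous L h)
    (h0 : ∀ f, 0 ≤ energy h 0 f) (m : ℤ) :
    MidconvexAlong (envelope h)
      (Matrix.vecMulVec (waveVector m) (waveVector m) : Mat) :=
  fun X s => le_ciInf_add_ciInf fun f₁ f₂ => hh.two_mul_envelope_le h0 m X s f₁ f₂

end Envelope

/-! ### From estimates on a domain to the kernel inclusion -/

section Domain

variable {h : Mat → ℝ} {L : ℝ}

/-- If the integral of `h` over Hessians of test functions on `Ω` is nonnegative, then so is its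
mean over Hessians of periodic functions: multiply rapid oscillations of the periodic function by
a fixed cutoff function and use the homogeneity of `h` to extract the cutoff. -/
theorem LipschitzHomogeneous.energy_nonneg (hh : LipschitzHomogeneous L h) {Ω : Set Plane}
    (hΩ : IsOpen Ω) (hne : Ω.Nonempty) (hbdd : Bornology.IsBounded Ω)
    (H : ∀ ϕ : Plane → ℝ, ContDiff ℝ ∞ ϕ → HasCompactSupport ϕ → tsupport ϕ ⊆ Ω →
      0 ≤ ∫ x in Ω, h (hess ϕ x)) (f : PeriodicPotential) : 0 ≤ energy h 0 f := by
  obtain ⟨c, hc⟩ := hne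
  obtain ⟨r, hr, hball⟩ := Metric.nhds_basis_closedBall.mem_iff.1 (hΩ.mem_nhds hc)
  let χ : ContDiffBump c := ⟨r / 2, r, by linarith, by linarith⟩
  have hχΩ : tsupport χ ⊆ Ω := χ.tsupport_eq.trans_subset hball
  have hχs : ContDiff ℝ ∞ χ := χ.contDiff
  have hχb := BoundedSmooth.of_hasCompactSupport hχs χ.hasCompactSupport
  have hfin : IsFiniteMeasure (volume.restrict Ω) := ⟨by simpa using hbdd.measure_lt_top⟩
  obtain ⟨M, -, hM⟩ := exists_norm_hess_oscillation_le hχb (f.2.2.boundedSmooth f.2.1)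
  have hχpos : 0 < ∫ x in Ω, χ x := by
    rw [setIntegral_eq_integral_of_forall_compl_eq_zero fun x hx =>
      image_eq_zero_of_notMem_tsupport fun h => hx (hχΩ h)]
    exact χ.integral_pos
  have hhom : ∀ (t : ℝ) (X : Mat), 0 ≤ t → h (t • X) = t * h X := fun t X ht => by
    rcases ht.eq_or_lt with rfl | ht
    · simp [hh.map_zero]
    · exact hh.map_smul t X ht
  have hf := isPeriodic_comp_add_hess h 0 f
  have hfc := hh.continuous.comp (continuous_add_hess 0 f)
  obtain ⟨B, hB⟩ := hf.exists_bound hfc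
  obtain ⟨A, hA⟩ := hχb.bounded
  have hmain : ∀ N : ℕ, 1 ≤ N → 0 ≤ (∫ x in Ω, χ x) * energy h 0 f +
      (L * M * (volume.restrict Ω).real univ) / N := by
    intro N hN
    have hN' : (1 : ℝ) ≤ N := by exact_mod_cast hN
    -- The two-scale lemma is applied with a vanishing second product.
    suffices key : ∀ z : Plane, -((L * M * (volume.restrict Ω).real univ) / N) ≤
        ∫ x in Ω, (χ x * h (0 + hess f.1 ((N : ℝ) • x + z)) + 0 * (0 : ℝ)) by
      have := le_of_forall_le_integral_oscillation hχs.continuous hχb.bounded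
        (continuous_const (y := (0 : ℝ))) ⟨0, by simp⟩ hfc hf (continuous_const (y := (0 : ℝ)))
        (fun _ _ => rfl) key
      simp only [Function.comp_apply, integral_zero, mul_zero, add_zero] at this
      simp only [energy]
      linarith
    intro z
    set ϕ : Plane → ℝ := fun x => ((N : ℝ) ^ 2)⁻¹ * (χ x * f.1 ((N : ℝ) • x + z))
    have hϕs : ContDiff ℝ ∞ ϕ :=
      contDiff_const.mul (hχs.mul (contDiff_comp_affine f.2.1 N z))
    have hsub : tsupport ϕ ⊆ tsupport χ :=
      (tsupport_mul_subset_right (f := fun _ => ((N : ℝ) ^ 2)⁻¹)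
        (g := fun x => χ x * f.1 ((N : ℝ) • x + z))).trans
        (tsupport_mul_subset_left (f := χ) (g := fun x => f.1 ((N : ℝ) • x + z)))
    have hϕc : HasCompactSupport ϕ := χ.hasCompactSupport.of_isClosed_subset
      (isClosed_tsupport ϕ) hsub
    have hpoint : ∀ x, h (hess ϕ x) ≤
        (χ x * h (0 + hess f.1 ((N : ℝ) • x + z)) + 0 * (0 : ℝ)) + L * (M / N) := by
      intro x
      have := hh.le_add (hM N z x hN')
      rw [hhom _ _ χ.nonneg] at this
      simpa using this
    have hi₁ : Integrable (fun x => h (hess ϕ x)) (volume.restrict Ω) := by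
      have hc : Continuous fun x => h (hess ϕ x) := hh.continuous.comp (continuous_hess hϕs)
      have hcs : HasCompactSupport fun x => h (hess ϕ x) :=
        (hasCompactSupport_hess hϕc).comp_left hh.map_zero
      exact (hc.integrable_of_hasCompactSupport hcs).restrict
    have hi₂ : Integrable (fun x => χ x * h (0 + hess f.1 ((N : ℝ) • x + z)) + 0 * (0 : ℝ))
        (volume.restrict Ω) := by
      refine integrable_of_bound ?_ ⟨A * B, fun x => ?_⟩
      · exact (hχs.continuous.mul (hfc.comp (f := fun x => (N : ℝ) • x + z)
          (by fun_prop))).add continuous_const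
      · rw [zero_mul, add_zero, abs_mul]
        exact mul_le_mul (hA x) (hB _) (abs_nonneg _) ((abs_nonneg _).trans (hA x))
    have hint := integral_mono hi₁ (hi₂.add (integrable_const (L * (M / N)))) hpoint
    have e : ∫ x in Ω, ((χ x * h (0 + hess f.1 ((N : ℝ) • x + z)) + 0 * (0 : ℝ)) + L * (M / N)) =
        (∫ x in Ω, (χ x * h (0 + hess f.1 ((N : ℝ) • x + z)) + 0 * (0 : ℝ))) +
          (L * M * (volume.restrict Ω).real univ) / N := by
      rw [integral_add hi₂ (integrable_const _), integral_const, smul_eq_mul]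
      ring
    have := ((H ϕ hϕs hϕc (hsub.trans hχΩ)).trans hint).trans_eq e
    linarith
  exact nonneg_of_mul_nonneg_right (le_of_forall_le_add_div hmain) hχpos

theorem mem_span_vecMulVec_waveVector {A : Mat} (hA : A.IsSymm) :
    A ∈ Submodule.span ℝ (↑(({-1, 0, 1} : Finset ℤ).image fun m =>
      (Matrix.vecMulVec (waveVector m) (waveVector m) : Mat)) : Set Mat) := by
  have hmem : ∀ m ∈ ({-1, 0, 1} : Finset ℤ),
      (Matrix.vecMulVec (waveVector m) (waveVector m) : Mat) ∈
      Submodule.span ℝ (↑(({-1, 0, 1} : Finset ℤ).image fun m =>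
        (Matrix.vecMulVec (waveVector m) (waveVector m) : Mat)) : Set Mat) := fun m hm =>
    Submodule.subset_span (Finset.mem_coe.2 (Finset.mem_image_of_mem _ hm))
  have e : A = ((A 0 0 + A 0 1) / 2) • (Matrix.vecMulVec (waveVector 1) (waveVector 1) : Mat) +
      ((A 0 0 - A 0 1) / 2) • (Matrix.vecMulVec (waveVector (-1)) (waveVector (-1)) : Mat) +
      (A 1 1 - A 0 0) • (Matrix.vecMulVec (waveVector 0) (waveVector 0) : Mat) := by
    have h10 : A 1 0 = A 0 1 := hA.apply 0 1
    ext i j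
    fin_cases i <;> fin_cases j <;> simp [waveVector, h10] <;> ring
  rw [e]
  exact add_mem (add_mem (Submodule.smul_mem _ _ (hmem 1 (by simp)))
    (Submodule.smul_mem _ _ (hmem (-1) (by simp)))) (Submodule.smul_mem _ _ (hmem 0 (by simp)))

theorem lipschitzHomogeneous_norm_sub_norm {E F₁ F₂ : Type*} [NormedAddCommGroup E]
    [NormedSpace ℝ E] [NormedAddCommGroup F₁] [NormedSpace ℝ F₁] [NormedAddCommGroup F₂]
    [NormedSpace ℝ F₂] [FiniteDimensional ℝ E] (P₁ : E →ₗ[ℝ] F₁) (P₂ : E →ₗ[ℝ] F₂) (C : ℝ) :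
    ∃ L, LipschitzHomogeneous L fun X => C * ‖P₂ X‖ - ‖P₁ X‖ := by
  set Q₁ : E →L[ℝ] F₁ := LinearMap.toContinuousLinearMap P₁
  set Q₂ : E →L[ℝ] F₂ := LinearMap.toContinuousLinearMap P₂
  refine ⟨|C| * ‖Q₂‖ + ‖Q₁‖, by positivity, fun X Y => ?_, fun t X ht => ?_⟩
  · have h₁ : |‖P₁ X‖ - ‖P₁ Y‖| ≤ ‖Q₁‖ * ‖X - Y‖ :=
      (abs_norm_sub_norm_le _ _).trans (by rw [← map_sub]; exact Q₁.le_opNorm _)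
    have h₂ : |‖P₂ X‖ - ‖P₂ Y‖| ≤ ‖Q₂‖ * ‖X - Y‖ :=
      (abs_norm_sub_norm_le _ _).trans (by rw [← map_sub]; exact Q₂.le_opNorm _)
    calc |C * ‖P₂ X‖ - ‖P₁ X‖ - (C * ‖P₂ Y‖ - ‖P₁ Y‖)|
        = |C * (‖P₂ X‖ - ‖P₂ Y‖) - (‖P₁ X‖ - ‖P₁ Y‖)| := by congr 1; ring
      _ ≤ |C| * |‖P₂ X‖ - ‖P₂ Y‖| + |‖P₁ X‖ - ‖P₁ Y‖| := by
        rw [← abs_mul]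
        exact abs_sub _ _
      _ ≤ |C| * (‖Q₂‖ * ‖X - Y‖) + ‖Q₁‖ * ‖X - Y‖ :=
        add_le_add (mul_le_mul_of_nonneg_left h₂ (abs_nonneg C)) h₁
      _ = _ := by ring
  · simp only [map_smul, norm_smul, Real.norm_of_nonneg ht.le]
    ring

theorem integrable_norm_map_hess {F : Type*} [NormedAddCommGroup F] [NormedSpace ℝ F]
    (P : Mat →ₗ[ℝ] F) {ϕ : Plane → ℝ} (hϕ : ContDiff ℝ ∞ ϕ) (hϕc : HasCompactSupport ϕ) :
    Integrable fun x => ‖P (hess ϕ x)‖ := by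
  have hP : Continuous P := P.continuous_of_finiteDimensional
  refine (hP.comp (continuous_hess hϕ)).norm.integrable_of_hasCompactSupport ?_
  exact (hasCompactSupport_hess hϕc).comp_left (g := fun X => ‖P X‖) (by simp)

variable {F₁ F₂ : Type*} [NormedAddCommGroup F₁] [NormedSpace ℝ F₁]
  [NormedAddCommGroup F₂] [NormedSpace ℝ F₂]

/-- An `L¹` estimate between two constant-coefficient second order operators on test functions
forces the kernel inclusion on symmetric matrices. -/
theorem map_eq_zero_of_integral_norm_le {Ω : Set Plane} (hΩ : IsOpen Ω) (hne : Ω.Nonempty)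
    (hbdd : Bornology.IsBounded Ω) (P₁ : Mat →ₗ[ℝ] F₁) (P₂ : Mat →ₗ[ℝ] F₂) (C : ℝ)
    (H : ∀ ϕ : Plane → ℝ, ContDiff ℝ ∞ ϕ → HasCompactSupport ϕ → tsupport ϕ ⊆ Ω →
      ∫ x in Ω, ‖P₁ (hess ϕ x)‖ ≤ C * ∫ x in Ω, ‖P₂ (hess ϕ x)‖)
    {A : Mat} (hA : A.IsSymm) (hPA : P₂ A = 0) : P₁ A = 0 := by
  obtain ⟨L, hh⟩ := lipschitzHomogeneous_norm_sub_norm P₁ P₂ C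
  have h0 := hh.energy_nonneg hΩ hne hbdd fun ϕ hϕ hϕc hϕΩ => by
    rw [integral_sub ((integrable_norm_map_hess P₂ hϕ hϕc).restrict.const_mul C)
      (integrable_norm_map_hess P₁ hϕ hϕc).restrict, integral_const_mul]
    exact sub_nonneg.2 (H ϕ hϕ hϕc hϕΩ)
  have hsum := (hh.lipschitzHomogeneous_envelope h0).nonneg_add_neg
    (({-1, 0, 1} : Finset ℤ).image fun m =>
      (Matrix.vecMulVec (waveVector m) (waveVector m) : Mat))
    (fun v hv => by
      obtain ⟨m, -, rfl⟩ := Finset.mem_image.1 hv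
      exact hh.midconvexAlong_envelope h0 m) (mem_span_vecMulVec_waveVector hA)
  have h1 := hh.envelope_le_self h0 A
  have h2 := hh.envelope_le_self h0 (-A)
  simp only [map_neg, norm_neg, hPA, norm_zero, mul_zero, zero_sub] at h1 h2
  have h3 : ‖P₁ A‖ ≤ 0 := by linarith
  exact norm_le_zero_iff.1 h3

end Domain

/-! ### Gradients and linear images of gradients -/

theorem fderiv_apply_single_apply {G : Plane → Plane} (hG : Differentiable ℝ G) (x : Plane)
    (i j : Fin 2) :
    fderiv ℝ G x (EuclideanSpace.single j 1) i = pd j (fun y => G y i) x := by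
  have h := ((EuclideanSpace.proj i : Plane →L[ℝ] ℝ).hasFDerivAt (x := G x)).comp x
    (hG x).hasFDerivAt
  rw [pd, show (fun y => G y i) = (EuclideanSpace.proj i : Plane →L[ℝ] ℝ) ∘ G from rfl, h.fderiv]
  rfl

theorem gradient_apply {f : Plane → ℝ} (x : Plane) (i : Fin 2) :
    (∇ f x) i = pd i f x := by
  have h : inner ℝ (∇ f x) (EuclideanSpace.single i (1 : ℝ)) = pd i f x := by
    rw [gradient, InnerProductSpace.toDual_symm_apply, pd]
  rw [← h, EuclideanSpace.inner_single_right]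
  simp

theorem contDiff_gradient {f : Plane → ℝ} (hf : ContDiff ℝ ∞ f) : ContDiff ℝ ∞ (∇ f) :=
  (InnerProductSpace.toDual ℝ Plane).symm.contDiff.comp (hf.fderiv_right (m := ∞) (by simp))

theorem tsupport_gradient_subset (f : Plane → ℝ) : tsupport (∇ f) ⊆ tsupport f := by
  refine Subset.trans (closure_mono fun x hx => ?_) (tsupport_fderiv_subset ℝ (f := f))
  rw [Function.mem_support] at hx ⊢
  intro h
  exact hx (by rw [gradient, h, map_zero])

/-- The Jacobian matrix of `B ∇f` is the product of `B` and the Hessian matrix of `f`. -/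
theorem jacobian_toEuclideanCLM_gradient {f : Plane → ℝ} (hf : ContDiff ℝ ∞ f) (B : Mat)
    (x : Plane) :
    jacobian (fun y => Matrix.toEuclideanCLM (𝕜 := ℝ) B (∇ f y)) x = B * hess f x := by
  have hd : Differentiable ℝ (∇ f) := (contDiff_gradient hf).differentiable (by simp)
  ext i j
  have h := (Matrix.toEuclideanCLM (𝕜 := ℝ) B).hasFDerivAt.comp x (hd x).hasFDerivAt
  rw [jacobian, Matrix.of_apply, show (fun y => Matrix.toEuclideanCLM (𝕜 := ℝ) B (∇ f y)) =
    Matrix.toEuclideanCLM (𝕜 := ℝ) B ∘ ∇ f from rfl, h.fderiv, Matrix.mul_apply]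
  simp only [ContinuousLinearMap.comp_apply, Matrix.ofLp_toEuclideanCLM, Matrix.mulVec,
    dotProduct, fderiv_apply_single_apply hd, gradient_apply, hess_apply]

/-- For a test function `ϕ` and a matrix `B`, the vector field `B ∇ϕ`. -/
noncomputable def linearGradient {Ω : Opens Plane} (B : Mat) (ϕ : 𝓓(Ω, ℝ)) : 𝓓(Ω, Plane) where
  toFun y := Matrix.toEuclideanCLM (𝕜 := ℝ) B (∇ ϕ y)
  contDiff' := (Matrix.toEuclideanCLM (𝕜 := ℝ) B).contDiff.comp (contDiff_gradient ϕ.contDiff)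
  hasCompactSupport' := HasCompactSupport.comp_left (f := ∇ ϕ)
    (ϕ.hasCompactSupport.of_isClosed_subset (isClosed_tsupport _) (tsupport_gradient_subset ϕ))
    (map_zero _)
  tsupport_subset' := ((closure_mono (Function.support_comp_subset (map_zero _) _)).trans
    (tsupport_gradient_subset ϕ)).trans ϕ.tsupport_subset

theorem linearGradient_one {Ω : Opens Plane} (ϕ : 𝓓(Ω, ℝ)) :
    ⇑(linearGradient 1 ϕ) = ∇ ϕ := by
  funext x
  change Matrix.toEuclideanCLM (𝕜 := ℝ) 1 (∇ ϕ x) = ∇ ϕ x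
  rw [map_one]
  rfl

theorem l1Norm_firstOrderOp_linearGradient {Ω : Opens Plane} {d : ℕ}
    (P : Mat →ₗ[ℝ] EuclideanSpace ℝ (Fin d)) (B : Mat) (ϕ : 𝓓(Ω, ℝ)) :
    l1Norm Ω (firstOrderOp P (linearGradient B ϕ)) =
      ∫ x in (Ω : Set Plane), ‖(P ∘ₗ LinearMap.mulLeft ℝ B) (hess ϕ x)‖ := by
  have h : ∀ x, jacobian (linearGradient B ϕ) x = B * hess ϕ x :=
    jacobian_toEuclideanCLM_gradient ϕ.contDiff B
  simp only [l1Norm, firstOrderOp, h, LinearMap.comp_apply, LinearMap.mulLeft_apply]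

/-- An `L¹` estimate on the vector fields `B ∇ϕ`, for a fixed matrix `B`, forces the kernel
inclusion on the matrices `B * S` with `S` symmetric. -/
theorem map_mul_eq_zero_of_l1Norm_le {Ω : Opens Plane} (hne : (Ω : Set Plane).Nonempty)
    (hbdd : Bornology.IsBounded (Ω : Set Plane)) {d₁ d₂ : ℕ}
    (P₁ : Mat →ₗ[ℝ] EuclideanSpace ℝ (Fin d₁)) (P₂ : Mat →ₗ[ℝ] EuclideanSpace ℝ (Fin d₂))
    (B : Mat) (C : ℝ)
    (H : ∀ ϕ : 𝓓(Ω, ℝ), l1Norm Ω (firstOrderOp P₁ (linearGradient B ϕ)) ≤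
      C * l1Norm Ω (firstOrderOp P₂ (linearGradient B ϕ)))
    {S : Mat} (hS : S.IsSymm) (h : P₂ (B * S) = 0) : P₁ (B * S) = 0 := by
  refine map_eq_zero_of_integral_norm_le Ω.isOpen hne hbdd (P₁ ∘ₗ LinearMap.mulLeft ℝ B)
    (P₂ ∘ₗ LinearMap.mulLeft ℝ B) C (fun ϕ hϕ hϕc hϕΩ => ?_) hS h
  have := H ⟨ϕ, hϕ, hϕc, hϕΩ⟩
  rwa [l1Norm_firstOrderOp_linearGradient, l1Norm_firstOrderOp_linearGradient] at this

/-- Every matrix is a product with a symmetric right factor: an invertible matrix is `A * 1`, and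
a singular one is unchanged by the orthogonal projection onto its row space. -/
theorem exists_eq_mul_isSymm (A : Mat) : ∃ B S : Mat, S.IsSymm ∧ A = B * S := by
  by_cases hdet : A.det = 0
  · obtain ⟨v, hv, hAv⟩ := Matrix.exists_mulVec_eq_zero_iff.2 hdet
    have hq : v 0 ^ 2 + v 1 ^ 2 ≠ 0 := by
      intro h
      refine hv (funext fun i => ?_)
      fin_cases i
      · simpa using (by nlinarith [sq_nonneg (v 0), sq_nonneg (v 1)] : v 0 ^ 2 = 0)
      · simpa using (by nlinarith [sq_nonneg (v 0), sq_nonneg (v 1)] : v 1 ^ 2 = 0)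
    refine ⟨A, 1 - (v 0 ^ 2 + v 1 ^ 2)⁻¹ • Matrix.vecMulVec v v, ?_, ?_⟩
    · ext i j
      fin_cases i <;> fin_cases j <;> simp [Matrix.vecMulVec_apply, mul_comm]
    · rw [mul_sub, Matrix.mul_smul, Matrix.mul_vecMulVec, hAv]
      simp
  · exact ⟨A, 1, Matrix.isSymm_one, (mul_one A).symm⟩

theorem exists_eq_comp_of_ker_le {V W U : Type*} [AddCommGroup V] [Module ℝ V]
    [AddCommGroup W] [Module ℝ W] [AddCommGroup U] [Module ℝ U]
    (f : V →ₗ[ℝ] W) (g : V →ₗ[ℝ] U) (h : LinearMap.ker f ≤ LinearMap.ker g) :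
    ∃ T : W →ₗ[ℝ] U, g = T ∘ₗ f := by
  obtain ⟨T, hT⟩ :=
    LinearMap.exists_extend ((LinearMap.ker f).liftQ g h ∘ₗ f.quotKerEquivRange.symm.toLinearMap)
  refine ⟨T, LinearMap.ext fun v => ?_⟩
  have hv := LinearMap.congr_fun hT (f.quotKerEquivRange (Submodule.Quotient.mk v))
  simpa using hv.symm

/-- The projection `A ↦ (A + Aᵀ) / 2` onto symmetric matrices. -/
noncomputable def symmetrize : Mat →ₗ[ℝ] Mat :=
  (1 / 2 : ℝ) • (LinearMap.id + (Matrix.transposeLinearEquiv (Fin 2) (Fin 2) ℝ ℝ).toLinearMap)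

theorem isSymm_symmetrize (A : Mat) : (symmetrize A).IsSymm := by
  ext i j
  simp [symmetrize, add_comm]

theorem symmetrize_eq {A : Mat} (hA : A.IsSymm) : symmetrize A = A := by
  have h : symmetrize A = (1 / 2 : ℝ) • (A + A.transpose) := rfl
  rw [h, hA.eq]
  module

end OrnsteinPlane

theorem theorem2 (Ω : Opens OrnsteinPlane.Plane)
    (hΩne : (Ω : Set OrnsteinPlane.Plane).Nonempty)
    (hΩbdd : Bornology.IsBounded (Ω : Set OrnsteinPlane.Plane))
    {d₁ d₂ : ℕ}
    (P₁ : OrnsteinPlane.Mat →ₗ[ℝ] EuclideanSpace ℝ (Fin d₁))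
    (P₂ : OrnsteinPlane.Mat →ₗ[ℝ] EuclideanSpace ℝ (Fin d₂)) :
    ((∃ C : ℝ, ∀ φ : 𝓓(Ω, OrnsteinPlane.Plane),
        OrnsteinPlane.l1Norm Ω (OrnsteinPlane.firstOrderOp P₁ φ) ≤
          C * OrnsteinPlane.l1Norm Ω (OrnsteinPlane.firstOrderOp P₂ φ)) →
      ∃ T : EuclideanSpace ℝ (Fin d₂) →ₗ[ℝ] EuclideanSpace ℝ (Fin d₁), P₁ = T ∘ₗ P₂) ∧
    ((∃ C : ℝ, ∀ φ : 𝓓(Ω, OrnsteinPlane.Plane), (∃ ϕ : 𝓓(Ω, ℝ), ⇑φ = ∇ ϕ) →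
        OrnsteinPlane.l1Norm Ω (OrnsteinPlane.firstOrderOp P₁ φ) ≤
          C * OrnsteinPlane.l1Norm Ω (OrnsteinPlane.firstOrderOp P₂ φ)) →
      ∃ T : EuclideanSpace ℝ (Fin d₂) →ₗ[ℝ] EuclideanSpace ℝ (Fin d₁),
        ∀ A : OrnsteinPlane.Mat, A.IsSymm → P₁ A = T (P₂ A)) := by
  refine ⟨fun ⟨C, H⟩ => ?_, fun ⟨C, H⟩ => ?_⟩
  · refine OrnsteinPlane.exists_eq_comp_of_ker_le P₂ P₁ fun A hA => ?_
    obtain ⟨B, S, hS, rfl⟩ := OrnsteinPlane.exists_eq_mul_isSymm A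
    exact OrnsteinPlane.map_mul_eq_zero_of_l1Norm_le hΩne hΩbdd P₁ P₂ B C (fun ϕ => H _) hS hA
  · obtain ⟨T, hT⟩ := OrnsteinPlane.exists_eq_comp_of_ker_le (P₂ ∘ₗ OrnsteinPlane.symmetrize)
      (P₁ ∘ₗ OrnsteinPlane.symmetrize) fun A hA => by
        have := OrnsteinPlane.map_mul_eq_zero_of_l1Norm_le hΩne hΩbdd P₁ P₂ 1 C
          (fun ϕ => H _ ⟨ϕ, OrnsteinPlane.linearGradient_one ϕ⟩)
          (OrnsteinPlane.isSymm_symmetrize A) (by rw [one_mul]; exact hA)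
        rwa [one_mul] at this
    refine ⟨T, fun A hA => ?_⟩
    have := LinearMap.congr_fun hT A
    simpa only [LinearMap.comp_apply, OrnsteinPlane.symmetrize_eq hA] using this
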